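/- Let $I\subseteq\mathbb R$ be an interval with $\inf I=0$ and let $R\subseteq\mathbb R$ be a subring with $1\in R$. For $n\ge 1$ let $$W_n(R)=\{(w_1,\dots,w_n)\in R^n : w_1,\dots,w_n\ge 0,\ w_1+\dots+w_n>0\}.$$ An $R$-weighted mean on $I$ is a function $\mathscr M\colon\bigcup_{n\ge1} I^n\times W_n(R)\to I$ such that for all $n\ge1$, $x\in I^n$ and $w,v\in W_n(R)$: (i) $\mathscr M(x,w)=\mathscr M(x,t\,w)$ for all $t\in R$ with $t>0$; (ii) $\mathscr M(x,w+v)=\mathscr M(x\odot x,\,w\odot v)$, where $(p_1,\dots,p_n)\odot(q_1,\dots,q_n)=(p_1,q_1,\dots,p_n,q_n)$; (iii) $\min(x_1,\dots,x_n)\le\mathscr M(x,w)\le\max(x_1,\dots,x_n)$; (iv) if $w_j=0$, then the value $\mathscr M(x,w)$ does not change when the $j$-th entry and the $j$-th weight are both omitted. The mean $\mathscr M$ is symmetric if $\mathscr M(x\circ\sigma,w\circ\sigma)=\mathscr M(x,w)$ for every permutation $\sigma$ of $\{1,\dots,n\}$, and monotone if it is nondecreasing in each of the entries $x_i$. Let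 $W^0(R)$ be the set of sequences $\lambda=(\lambda_n)_{n\ge1}$ with $\lambda_n\in R$ and $\lambda_n>0$ for all $n$. For $\lambda\in W^0(R)$ let $\mathscr H_{\mathscr M}(\lambda)\in[0,+\infty]$ be the smallest $C\in[0,+\infty]$ such that $$\sum_{n=1}^\infty\lambda_n\,\mathscr M\big((x_1,\dots,x_n),(\lambda_1,\dots,\lambda_n)\big)\le C\sum_{n=1}^\infty\lambda_nx_n$$ for all sequences $(x_n)_{n\ge1}$ in $I$, where the sums are taken in $[0,+\infty]$. **Theorem.** Let $\mathscr M$ be a symmetric, monotone $R$-weighted mean on $I$, let $\lambda\in W^0(R)$, and put $\Lambda_n=\lambda_1+\dots+\lambda_n$. If $\Lambda_n\to\infty$ and $\lambda_n/\Lambda_n\to0$ as $n\to\infty$, then $$\mathscr H_{\mathscr M}(\lambda)=\mathscr H_{\mathscr M}(\mathbf 1),\qquad\text{where }\mathbf 1=(1,1,1,\dots).$$ -/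

import Mathlib

open Filter Topology
open scoped ENNReal

/-- The set `W_n(R)` of `n`-dimensional weight vectors over the ring `R ⊆ ℝ`: vectors with
nonnegative entries in `R` and positive sum. (For `n = 0` this set is empty.) -/
def weightVectors (R : Subring ℝ) (n : ℕ) : Set (Fin n → ℝ) :=
  {w | (∀ i, w i ∈ R) ∧ (∀ i, 0 ≤ w i) ∧ 0 < ∑ i, w i}

/-- The set `W⁰(R)` of infinite sequences of strictly positive weights in `R`. -/
def positiveWeightSequences (R : Subring ℝ) : Set (ℕ → ℝ) :=
  {w | ∀ n, w n ∈ R ∧ 0 < w n}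

/-- The shuffle `(p₁, …, pₙ) ⊙ (q₁, …, qₙ) = (p₁, q₁, …, pₙ, qₙ)`. With 0-based indices, entry
`k` is entry `k / 2` of `p` if `k` is even, and entry `k / 2` of `q` if `k` is odd. -/
def shuffle {n : ℕ} (p q : Fin n → ℝ) : Fin (n * 2) → ℝ :=
  fun k => if (k : ℕ) % 2 = 0 then p k.divNat else q k.divNat

/-- An `R`-weighted mean on `I`, that is, a function `⋃ₙ Iⁿ × W_n(R) → I` satisfying the four
axioms below. The underlying function is written as a total function; all axioms concern only
its values on `Iⁿ × W_n(R)`, and the values elsewhere are irrelevant. -/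
structure WeightedMean (I : Set ℝ) (R : Subring ℝ) where
  /-- the value `M(x, w)` -/
  val : (n : ℕ) → (Fin n → ℝ) → (Fin n → ℝ) → ℝ
  /-- the values lie in `I` -/
  val_mem : ∀ (n : ℕ) (x w : Fin n → ℝ), (∀ i, x i ∈ I) → w ∈ weightVectors R n →
    val n x w ∈ I
  /-- nullhomogeneity in the weights -/
  nullhomogeneous : ∀ (n : ℕ) (x w : Fin n → ℝ), (∀ i, x i ∈ I) → w ∈ weightVectors R n →
    ∀ t ∈ R, 0 < t → val n x w = val n x (fun i => t * w i)
  /-- reduction principle -/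
  reduction : ∀ (n : ℕ) (x w v : Fin n → ℝ), (∀ i, x i ∈ I) → w ∈ weightVectors R n →
    v ∈ weightVectors R n →
    val n x (fun i => w i + v i) = val (n * 2) (shuffle x x) (shuffle w v)
  /-- mean value property: `min xᵢ ≤ M(x, w) ≤ max xᵢ` -/
  mean_value : ∀ (n : ℕ) (x w : Fin n → ℝ), (∀ i, x i ∈ I) → w ∈ weightVectors R n →
    (∃ i, x i ≤ val n x w) ∧ (∃ j, val n x w ≤ x j)
  /-- elimination principle: an entry with a zero weight can be omitted -/
  elimination : ∀ (n : ℕ) (x w : Fin (n + 1) → ℝ), (∀ i, x i ∈ I) →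
    w ∈ weightVectors R (n + 1) → ∀ j, w j = 0 →
    val (n + 1) x w = val n (fun i => x (j.succAbove i)) (fun i => w (j.succAbove i))

namespace WeightedMean

variable {I : Set ℝ} {R : Subring ℝ}

/-- `M` is symmetric: it is invariant under simultaneous permutations of entries and weights. -/
def IsSymmetric (M : WeightedMean I R) : Prop :=
  ∀ (n : ℕ) (x w : Fin n → ℝ), (∀ i, x i ∈ I) → w ∈ weightVectors R n →
    ∀ σ : Equiv.Perm (Fin n), M.val n x w = M.val n (x ∘ σ) (w ∘ σ)

/-- `M` is monotone: it is nondecreasing in each of its entries. -/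
def IsMonotone (M : WeightedMean I R) : Prop :=
  ∀ (n : ℕ) (x w : Fin n → ℝ), (∀ i, x i ∈ I) → w ∈ weightVectors R n →
    ∀ (i : Fin n) (a b : ℝ), a ∈ I → b ∈ I → a ≤ b →
      M.val n (Function.update x i a) w ≤ M.val n (Function.update x i b) w

/-- The `w`-weighted Hardy constant of `M` (for `w ∈ W⁰(R)` and `I ⊆ [0, ∞)`): the smallest
`C ∈ [0, ∞]` such that
`∑ₙ wₙ M((x₁, …, xₙ), (w₁, …, wₙ)) ≤ C ∑ₙ wₙ xₙ` for all sequences `x` in `I`.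
All terms are nonnegative, and the sums are taken in `[0, ∞]`. -/
noncomputable def hardyConstant (M : WeightedMean I R) (w : ℕ → ℝ) : ℝ≥0∞ :=
  sInf {C : ℝ≥0∞ | ∀ x : ℕ → ℝ, (∀ n, x n ∈ I) →
    ∑' n : ℕ, ENNReal.ofReal
        (w n * M.val (n + 1) (fun i : Fin (n + 1) => x i) (fun i : Fin (n + 1) => w i))
      ≤ C * ∑' n : ℕ, ENNReal.ofReal (w n * x n)}

end WeightedMean

/-! Among all weight sequences, those with divergent partial sums and `aₙ / (a₀ + ⋯ + aₙ) → 0` have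
the largest Hardy constant (`hardyConstant_le`). Since `w` and the constant `1` both qualify, the
two constants coincide.

To compare arbitrary weights `b` with such an `a`, view `y₀, …, y_{N-1}` as a step function on a
time axis with steps of length `bᵢ`, stretch time by a large `T`, and sample its decreasing
rearrangement on the grid with steps `aₙ` (`exists_rearrangement`). For large `T` this grid is fine
relative to `T` (`exists_scale_of_tendsto_ratio`), so the layer-cake formula shows that the weighted
sum grows by the factor `T` up to a small error. Rearranging puts large values first, so the initial
segments of the new sequence stochastically dominate those of `y` at earlier or equal stretched
times. Symmetric monotone means respect this dominance (`val_le_val_of_stochastic_dominance`).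
Summing over the blocks of the stretched axis, dividing by `T` and letting the error tend to `0`
gives the inequality. -/

namespace WeightedMean

variable {I : Set ℝ} {R : Subring ℝ}

/-! ### Rearranging and splitting weights -/

/-- Entries of weight zero may be dropped, and the others reindexed. -/
theorem IsSymmetric.val_comp_injective {M : WeightedMean I R} (hsymm : M.IsSymmetric) {m : ℕ} :
    ∀ {n : ℕ} (f : Fin m → Fin n), Function.Injective f → ∀ (x w : Fin n → ℝ),
      (∀ i, x i ∈ I) → w ∈ weightVectors R n → (∀ i, i ∉ Set.range f → w i = 0) →
      M.val n x w = M.val m (x ∘ f) (w ∘ f) := by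
  intro n
  induction n with
  | zero =>
    intro f _ x w _ hw _
    exact absurd hw.2.2 (by simp)
  | succ n ih =>
    intro f hf x w hx hw h0
    by_cases hs : Function.Surjective f
    · have hmn : m = n + 1 := by
        simpa using Fintype.card_congr (Equiv.ofBijective f ⟨hf, hs⟩)
      subst hmn
      exact hsymm _ x w hx hw (Equiv.ofBijective f ⟨hf, hs⟩)
    · obtain ⟨j, hj⟩ : ∃ j, ∀ i, f i ≠ j := by simpa [Function.Surjective] using hs
      have hwj : w j = 0 := h0 j (by simpa using hj)
      choose g hg using fun i => Fin.exists_succAbove_eq (hj i)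
      have hfg : f = j.succAbove ∘ g := funext fun i => (hg i).symm
      rw [M.elimination n x w hx hw j hwj]
      rw [ih g (fun a b hab => hf (by rw [← hg a, ← hg b, hab])) _ _ (fun i => hx _)
        ⟨fun i => hw.1 _, fun i => hw.2.1 _, ?_⟩ ?_]
      · subst hfg; rfl
      · have := hw.2.2
        rwa [Fin.sum_univ_succAbove _ j, hwj, zero_add] at this
      · intro i hi
        refine h0 _ ?_
        rintro ⟨k, hk⟩
        exact hi ⟨k, Fin.succAbove_right_injective ((hg k).trans hk)⟩

theorem weightVectors_snoc {n : ℕ} {w : Fin n → ℝ} {d : ℝ} (hwR : ∀ i, w i ∈ R)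
    (hw0 : ∀ i, 0 ≤ w i) (hd : d ∈ R) (hd0 : 0 < d) :
    (Fin.snoc w d : Fin (n + 1) → ℝ) ∈ weightVectors R (n + 1) := by
  refine ⟨fun i => ?_, fun i => ?_, ?_⟩
  · induction i using Fin.lastCases <;> simp [hd, hwR]
  · induction i using Fin.lastCases <;> simp [hd0.le, hw0]
  · rw [Fin.sum_univ_castSucc]
    simp only [Fin.snoc_castSucc, Fin.snoc_last]
    exact add_pos_of_nonneg_of_pos (Finset.sum_nonneg fun i _ => hw0 i) hd0

/-- A part of the weight of an entry may be split off to a new copy of that entry. -/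
theorem IsSymmetric.val_add_single {M : WeightedMean I R} (hsymm : M.IsSymmetric) {n : ℕ}
    {x w : Fin n → ℝ} (hx : ∀ i, x i ∈ I) (hwR : ∀ i, w i ∈ R) (hw0 : ∀ i, 0 ≤ w i)
    {d : ℝ} (hd : d ∈ R) (hd0 : 0 < d) (i : Fin n) :
    M.val n x (fun k => w k + (Pi.single i d : Fin n → ℝ) k) =
      M.val (n + 1) (Fin.snoc x (x i)) (Fin.snoc w d) := by
  have hxs : ∀ k, (Fin.snoc x (x i) : Fin (n + 1) → ℝ) k ∈ I := fun k => by
    induction k using Fin.lastCases <;> simp [hx]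
  have hws := weightVectors_snoc (R := R) hwR hw0 hd hd0
  -- If `w i = 0`, then `w` may vanish identically and the reduction principle may not apply; here
  -- the new entry simply replaces entry `i`.
  rcases (hw0 i).eq_or_lt with hi | hi
  · rw [hsymm.val_comp_injective (fun k => if k = i then Fin.last n else k.castSucc) ?_ _ _
      hxs hws ?_]
    · congr 1
      · funext k
        by_cases hk : k = i <;> simp [hk]
      · funext k
        by_cases hk : k = i
        · subst hk; simp [← hi]
        · simp [hk]
    · intro k l hkl
      by_cases hk : k = i <;> by_cases hl : l = i <;>
        simp [hk, hl, Fin.castSucc_ne_last, (Fin.castSucc_ne_last _).symm] at hkl ⊢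
      exact hkl
    · intro k hk
      induction k using Fin.lastCases with
      | last => exact absurd ⟨i, by simp⟩ hk
      | cast k =>
        by_cases hki : k = i
        · subst hki; simp [← hi]
        · exact absurd ⟨k, by simp [hki]⟩ hk
  · have hw : w ∈ weightVectors R n :=
      ⟨hwR, hw0, hi.trans_le (Finset.single_le_sum (fun k _ => hw0 k) (Finset.mem_univ i))⟩
    have hδ : (Pi.single i d : Fin n → ℝ) ∈ weightVectors R n := by
      refine ⟨fun k => ?_, fun k => ?_, by simpa using hd0⟩
      · by_cases hk : k = i
        · subst hk; simpa using hd
        · simp [hk, R.zero_mem]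
      · by_cases hk : k = i
        · subst hk; simpa using hd0.le
        · simp [hk]
    rw [M.reduction n x w _ hx hw hδ]
    have hshR : shuffle w (Pi.single i d : Fin n → ℝ) ∈ weightVectors R (n * 2) := by
      have hnn : ∀ k, 0 ≤ shuffle w (Pi.single i d : Fin n → ℝ) k := fun k => by
        unfold shuffle; split_ifs
        exacts [hw0 _, hδ.2.1 _]
      refine ⟨fun k => ?_, hnn, ?_⟩
      · unfold shuffle; split_ifs
        exacts [hwR _, hδ.1 _]
      · refine lt_of_lt_of_le ?_ (Finset.single_le_sum (fun k _ => hnn k)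
          (Finset.mem_univ (⟨2 * i, by omega⟩ : Fin (n * 2))))
        simpa [shuffle, Fin.divNat] using hi
    -- The surviving positions of the shuffle are the even ones, which carry `w`, and `2 * i + 1`,
    -- which carries `d`.
    have hf : ∀ k : Fin (n + 1),
        (if (k : ℕ) = n then 2 * (i : ℕ) + 1 else 2 * (k : ℕ)) < n * 2 := fun k => by
      split_ifs <;> omega
    rw [hsymm.val_comp_injective (fun k : Fin (n + 1) => (⟨_, hf k⟩ : Fin (n * 2))) ?_ _ _
      (fun k => by unfold shuffle; split_ifs <;> exact hx _) hshR ?_]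
    · congr 1
      · funext k
        induction k using Fin.lastCases with
        | last => simp [shuffle, Fin.divNat, Nat.mul_add_div]
        | cast k => simp [shuffle, Fin.divNat, k.2.ne]
      · funext k
        induction k using Fin.lastCases with
        | last => simp [shuffle, Fin.divNat, Nat.mul_add_div]
        | cast k => simp [shuffle, Fin.divNat, k.2.ne]
    · intro k l hkl
      have := congrArg Fin.val hkl
      simp only at this
      ext
      split_ifs at this <;> omega
    · intro k hk
      rcases Nat.mod_two_eq_zero_or_one k with h | h
      · refine absurd ⟨⟨k / 2, by omega⟩, ?_⟩ hk
        ext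
        have : (k : ℕ) / 2 ≠ n := by omega
        simp only [this, if_false]
        omega
      · have hne : k.divNat ≠ i := by
          intro hki
          refine hk ⟨Fin.last n, ?_⟩
          ext
          have : (k : ℕ) / 2 = i := congrArg Fin.val hki
          simp only [Fin.val_last, if_true]
          omega
        simp [shuffle, h, hne]

/-! ### Stochastic dominance -/

/-- Moving weight from an entry to a larger entry does not decrease the mean. -/
theorem val_le_val_of_transfer {M : WeightedMean I R} (hsymm : M.IsSymmetric)
    (hmono : M.IsMonotone) {n : ℕ} {x w : Fin n → ℝ} (hx : ∀ i, x i ∈ I)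
    (hwR : ∀ i, w i ∈ R) (hw0 : ∀ i, 0 ≤ w i) {d : ℝ} (hd : d ∈ R) (hd0 : 0 < d) {i j : Fin n}
    (hij : x i ≤ x j) :
    M.val n x (fun k => w k + (Pi.single i d : Fin n → ℝ) k) ≤
      M.val n x (fun k => w k + (Pi.single j d : Fin n → ℝ) k) := by
  rw [hsymm.val_add_single hx hwR hw0 hd hd0, hsymm.val_add_single hx hwR hw0 hd hd0]
  have := hmono (n + 1) (Fin.snoc x (x i)) (Fin.snoc w d)
    (fun k => by induction k using Fin.lastCases <;> simp [hx])
    (weightVectors_snoc hwR hw0 hd hd0) (Fin.last n) (x i) (x j) (hx i) (hx j) hij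
  simpa [Fin.update_snoc_last] using this

/-- A mean is monotone with respect to first-order stochastic dominance of weights of equal total
on a common tuple of entries. -/
theorem val_le_val_of_tail_sum_le {M : WeightedMean I R} (hsymm : M.IsSymmetric)
    (hmono : M.IsMonotone) {n : ℕ} {x : Fin n → ℝ} (hx : ∀ i, x i ∈ I) {v : Fin n → ℝ}
    (hv : v ∈ weightVectors R n) (k : ℕ) : ∀ {u : Fin n → ℝ}, u ∈ weightVectors R n →
    (Finset.univ.filter fun i => u i ≠ v i).card ≤ k →
    ∑ i, u i = ∑ i, v i →
    (∀ c, ∑ i with c ≤ x i, u i ≤ ∑ i with c ≤ x i, v i) →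
    M.val n x u ≤ M.val n x v := by
  induction k with
  | zero =>
    intro u _ hk _ _
    have : u = v := funext fun i => by
      have := Finset.card_eq_zero.1 (Nat.le_zero.1 hk)
      simpa using (Finset.filter_eq_empty_iff.1 this) (Finset.mem_univ i)
    rw [this]
  | succ k ih =>
    intro u hu hk hsum hdom
    by_cases hle : ∀ i, u i ≤ v i
    · have : u = v := funext fun i =>
        (Finset.sum_eq_sum_iff_of_le fun i _ => hle i).1 hsum i (Finset.mem_univ i)
      rw [this]
    push Not at hle
    -- Take the surplus position with the largest entry. Dominance at the level `x i` then forces a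
    -- deficit at some entry at least as large, and moving the smaller of the two discrepancies
    -- settles one position.
    obtain ⟨i, hi, hmax⟩ : ∃ i, v i < u i ∧ ∀ l, v l < u l → x l ≤ x i := by
      obtain ⟨i₀, hi₀⟩ := hle
      obtain ⟨i, hi, h⟩ := Finset.exists_max_image (Finset.univ.filter fun i => v i < u i) x
        ⟨i₀, by simpa using hi₀⟩
      exact ⟨i, by simpa using hi, fun l hl => h l (by simpa using hl)⟩
    obtain ⟨j, hij, hj⟩ : ∃ j, x i ≤ x j ∧ u j < v j := by
      by_contra! hcon
      refine (hdom (x i)).not_gt (Finset.sum_lt_sum (fun l hl => hcon l (by simpa using hl))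
        ⟨i, by simp, hi⟩)
    have hne : i ≠ j := by rintro rfl; exact hi.not_gt hj
    set d := min (u i - v i) (v j - u j) with hd
    have hd0 : 0 < d := lt_min (by linarith) (by linarith)
    have hdi : d ≤ u i - v i := min_le_left _ _
    have hdj : d ≤ v j - u j := min_le_right _ _
    have hdR : d ∈ R := by
      rcases min_choice (u i - v i) (v j - u j) with h | h <;> rw [hd, h]
      exacts [R.sub_mem (hu.1 i) (hv.1 i), R.sub_mem (hv.1 j) (hu.1 j)]
    set r : Fin n → ℝ := fun l => u l - (Pi.single i d : Fin n → ℝ) l with hr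
    have hsR : ∀ l m, (Pi.single l d : Fin n → ℝ) m ∈ R := fun l m => by
      by_cases h : m = l
      · subst h; simpa using hdR
      · simp [h, R.zero_mem]
    have hs0 : ∀ l m, 0 ≤ (Pi.single l d : Fin n → ℝ) m := fun l m => by
      by_cases h : m = l
      · subst h; simpa using hd0.le
      · simp [h]
    have hrR : ∀ l, r l ∈ R := fun l => R.sub_mem (hu.1 l) (hsR _ _)
    have hr0 : ∀ l, 0 ≤ r l := fun l => by
      by_cases h : l = i
      · subst h
        have := hv.2.1 l
        simp only [hr, Pi.single_eq_same]; linarith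
      · simpa [hr, h] using hu.2.1 l
    have hu' : u = fun l => r l + (Pi.single i d : Fin n → ℝ) l := by funext l; simp [hr]
    set u' : Fin n → ℝ := fun l => r l + (Pi.single j d : Fin n → ℝ) l with hu'd
    have hstep : M.val n x u ≤ M.val n x u' := by
      conv_lhs => rw [hu']
      exact val_le_val_of_transfer hsymm hmono hx hrR hr0 hdR hd0 hij
    have hsum' : ∀ s : Finset (Fin n), (i ∈ s → j ∈ s → ∑ l ∈ s, u' l = ∑ l ∈ s, u l) := by
      intro s his hjs
      conv_rhs => rw [hu']
      simp [hu'd, Finset.sum_add_distrib, Finset.sum_pi_single', his, hjs]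
    have hui : u' i = u i - d := by simp [hu'd, hr, hne]
    have huj : u' j = u j + d := by simp [hu'd, hr, hne.symm]
    have hul : ∀ l, l ≠ i → l ≠ j → u' l = u l := fun l h1 h2 => by simp [hu'd, hr, h1, h2]
    have htot : ∑ l, u' l = ∑ l, u l := hsum' _ (Finset.mem_univ _) (Finset.mem_univ _)
    refine hstep.trans (ih ⟨fun l => R.add_mem (hrR l) (hsR _ _),
      fun l => add_nonneg (hr0 l) (hs0 _ _), htot ▸ hu.2.2⟩ ?_ (htot.trans hsum) ?_)
    · refine Nat.lt_succ_iff.1 (lt_of_lt_of_le (Finset.card_lt_card ?_) hk)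
      rw [Finset.ssubset_iff_of_subset]
      · rcases min_choice (u i - v i) (v j - u j) with h | h
        · exact ⟨i, by simpa using hi.ne', by simp [hui, hd, h]⟩
        · exact ⟨j, by simpa using hj.ne, by simp [huj, hd, h]⟩
      · intro l hl
        simp only [Finset.mem_filter, Finset.mem_univ, true_and] at hl ⊢
        by_cases h1 : l = i
        · subst h1; exact hi.ne'
        by_cases h2 : l = j
        · subst h2; exact hj.ne
        rwa [← hul l h1 h2]
    · intro c
      by_cases hc : c ≤ x i
      · rw [hsum' _ (by simpa using hc) (by simpa using hc.trans hij)]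
        exact hdom c
      -- Above the level `x i` no surplus remains, by the choice of `i`, so the tails compare
      -- termwise.
      · refine Finset.sum_le_sum fun l hl => ?_
        have hxl : x i < x l := (not_le.1 hc).trans_le (by simpa using hl)
        have h1 : l ≠ i := by rintro rfl; exact hxl.ne rfl
        by_cases h2 : l = j
        · subst h2; linarith
        rw [hul l h1 h2]
        by_contra! h
        exact (hmax l h).not_gt hxl

/-- A symmetric, monotone mean is monotone with respect to first-order stochastic dominance. -/
theorem val_le_val_of_stochastic_dominance {M : WeightedMean I R} (hsymm : M.IsSymmetric)
    (hmono : M.IsMonotone) {m n : ℕ} {p u : Fin m → ℝ} {q v : Fin n → ℝ}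
    (hp : ∀ i, p i ∈ I) (hq : ∀ i, q i ∈ I) (hu : u ∈ weightVectors R m)
    (hv : v ∈ weightVectors R n)
    (h : ∀ c, (∑ j, v j) * ∑ i with c ≤ p i, u i ≤ (∑ i, u i) * ∑ j with c ≤ q j, v j) :
    M.val m p u ≤ M.val n q v := by
  set U := ∑ i, u i with hU
  set V := ∑ j, v j with hV
  have hUR : U ∈ R := R.sum_mem fun i _ => hu.1 i
  have hVR : V ∈ R := R.sum_mem fun i _ => hv.1 i
  have hU0 : 0 < U := hu.2.2
  have hV0 : 0 < V := hv.2.2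
  -- Cross-multiplying by the totals equalizes them without division, so the weights stay in `R`.
  set x : Fin (m + n) → ℝ := Fin.append p q
  set u' : Fin (m + n) → ℝ := Fin.append (fun i => V * u i) 0
  set v' : Fin (m + n) → ℝ := Fin.append 0 (fun j => U * v j)
  have hx : ∀ i, x i ∈ I := fun i => by
    induction i using Fin.addCases <;> simp [x, hp, hq]
  have hu' : u' ∈ weightVectors R (m + n) := by
    refine ⟨fun i => ?_, fun i => ?_, ?_⟩
    · induction i using Fin.addCases <;> simp [u', R.mul_mem, hVR, hu.1, R.zero_mem]
    · induction i using Fin.addCases <;> simp [u', mul_nonneg, hV0.le, hu.2.1]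
    · simpa [Fin.sum_univ_add, u', ← Finset.mul_sum, ← hU] using mul_pos hV0 hU0
  have hv' : v' ∈ weightVectors R (m + n) := by
    refine ⟨fun i => ?_, fun i => ?_, ?_⟩
    · induction i using Fin.addCases <;> simp [v', R.mul_mem, hUR, hv.1, R.zero_mem]
    · induction i using Fin.addCases <;> simp [v', mul_nonneg, hU0.le, hv.2.1]
    · simpa [Fin.sum_univ_add, v', ← Finset.mul_sum, ← hV] using mul_pos hU0 hV0
  have e1 : M.val m p u = M.val (m + n) x u' := by
    rw [M.nullhomogeneous m p u hp hu V hVR hV0,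
      hsymm.val_comp_injective (Fin.castAdd n) (Fin.castAdd_injective m n) x u' hx hu' ?_]
    · congr 1 <;> funext i <;> simp [x, u']
    · intro i hi
      induction i using Fin.addCases with
      | left i => exact absurd ⟨i, rfl⟩ hi
      | right i => simp [u']
  have e2 : M.val n q v = M.val (m + n) x v' := by
    rw [M.nullhomogeneous n q v hq hv U hUR hU0,
      hsymm.val_comp_injective (Fin.natAdd m) (Fin.natAdd_injective n m) x v' hx hv' ?_]
    · congr 1 <;> funext i <;> simp [x, v']
    · intro i hi
      induction i using Fin.addCases with
      | left i => simp [v']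
      | right i => exact absurd ⟨i, rfl⟩ hi
  rw [e1, e2]
  refine val_le_val_of_tail_sum_le hsymm hmono hx hv' _ hu' le_rfl ?_ fun c => ?_
  · simp [Fin.sum_univ_add, u', v', ← Finset.mul_sum, ← hU, ← hV, mul_comm U V]
  · have := h c
    simp only [Finset.sum_filter] at this ⊢
    simpa [Fin.sum_univ_add, u', v', x, Finset.mul_sum, mul_ite] using this

end WeightedMean

/-! ### Layer cake and sampling estimates -/

/-- The layer-cake comparison of two finite sums whose tails are comparable up to an error. -/
theorem sum_mul_le_of_tail_sum_le {ι κ : Type*} (s : Finset ι) (t : Finset κ) {u x : ι → ℝ}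
    {v y : κ → ℝ} {K Y : ℝ} (hY : 0 ≤ Y) (hx : ∀ i ∈ s, 0 ≤ x i ∧ x i ≤ Y)
    (hy : ∀ j ∈ t, 0 ≤ y j ∧ y j ≤ Y)
    (h : ∀ c, 0 < c → ∑ i ∈ s with c ≤ x i, u i ≤ ∑ j ∈ t with c ≤ y j, v j + K) :
    ∑ i ∈ s, u i * x i ≤ ∑ j ∈ t, v j * y j + K * Y := by
  have key : ∀ a b : ℝ, 0 ≤ b → b ≤ Y →
      IntervalIntegrable (fun c => if c ≤ b then a else 0) MeasureTheory.volume 0 Y ∧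
      ∫ c in (0 : ℝ)..Y, (if c ≤ b then a else 0) = a * b := by
    intro a b hb hbY
    have h1 : Set.EqOn (fun _ : ℝ => a) (fun c => if c ≤ b then a else 0) (Set.uIoc 0 b) := by
      intro c hc
      rw [Set.uIoc_of_le hb] at hc
      simp [hc.2]
    have h2 : Set.EqOn (fun _ : ℝ => (0 : ℝ)) (fun c => if c ≤ b then a else 0)
        (Set.uIoc b Y) := by
      intro c hc
      rw [Set.uIoc_of_le hbY] at hc
      simp [hc.1]
    have i1 := (intervalIntegrable_const (μ := MeasureTheory.volume) (a := 0) (b := b)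
      (c := a)).congr h1
    have i2 := (intervalIntegrable_const (μ := MeasureTheory.volume) (a := b) (b := Y)
      (c := (0 : ℝ))).congr h2
    refine ⟨i1.trans i2, ?_⟩
    rw [← intervalIntegral.integral_add_adjacent_intervals i1 i2,
      ← intervalIntegral.integral_congr_ae (.of_forall h1),
      ← intervalIntegral.integral_congr_ae (.of_forall h2)]
    simp [mul_comm]
  have e1 : ∑ i ∈ s, u i * x i = ∫ c in (0 : ℝ)..Y, ∑ i ∈ s, (if c ≤ x i then u i else 0) := by
    rw [intervalIntegral.integral_finsetSum fun i hi => (key _ _ (hx i hi).1 (hx i hi).2).1]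
    exact Finset.sum_congr rfl fun i hi => (key _ _ (hx i hi).1 (hx i hi).2).2.symm
  have j2 : IntervalIntegrable (fun c => ∑ j ∈ t, (if c ≤ y j then v j else 0))
      MeasureTheory.volume 0 Y := by
    have := IntervalIntegrable.sum t fun j hj =>
      (key (v j) _ (hy j hj).1 (hy j hj).2).1
    refine this.congr fun c _ => ?_
    simp
  have j1 : IntervalIntegrable (fun c => ∑ i ∈ s, (if c ≤ x i then u i else 0))
      MeasureTheory.volume 0 Y := by
    have := IntervalIntegrable.sum s fun i hi =>
      (key (u i) _ (hx i hi).1 (hx i hi).2).1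
    refine this.congr fun c _ => ?_
    simp
  have e2 : ∑ j ∈ t, v j * y j + K * Y =
      ∫ c in (0 : ℝ)..Y, (∑ j ∈ t, (if c ≤ y j then v j else 0) + K) := by
    rw [intervalIntegral.integral_add j2 intervalIntegrable_const,
      intervalIntegral.integral_finsetSum fun i hi => (key _ _ (hy i hi).1 (hy i hi).2).1]
    simp only [intervalIntegral.integral_const, sub_zero, smul_eq_mul, mul_comm K]
    congr 1
    exact Finset.sum_congr rfl fun i hi => (key _ _ (hy i hi).1 (hy i hi).2).2.symm
  rw [e1, e2]
  refine intervalIntegral.integral_mono_on_of_le_Ioo hY j1 (j2.add intervalIntegrable_const) ?_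
  intro c hc
  simpa [Finset.sum_filter] using h c hc.1

/-- Consecutive steps of lengths `aₙ` that start before `s` cover everything up to `s`, or up to the
end of the grid. -/
theorem min_le_sum_filter_partial_sum_lt (a : ℕ → ℝ) (s : ℝ) (hs : 0 ≤ s)
    (k : ℕ) :
    min (∑ i ∈ Finset.range k, a i) s ≤
      ∑ n ∈ Finset.range k with ∑ i ∈ Finset.range n, a i < s, a n := by
  induction k with
  | zero => simp [hs]
  | succ k ih =>
    rw [Finset.range_add_one, Finset.filter_insert]
    split_ifs with h
    · rw [Finset.sum_insert (by simp), Finset.sum_insert (by simp)]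
      rw [min_eq_left h.le] at ih
      exact (min_le_left _ _).trans (by linarith)
    · rw [min_eq_right (not_lt.1 h)] at ih
      exact (min_le_right _ _).trans ih

/-- Only the last step starting before `s` can reach beyond `s`. Bounding by the full partial sum as
well makes the induction work. -/
theorem sum_filter_partial_sum_lt_le (a : ℕ → ℝ) (s δ : ℝ) (ha : ∀ n, 0 ≤ a n) (hs : 0 ≤ s)
    (hδ : 0 ≤ δ) (h : ∀ n, ∑ i ∈ Finset.range n, a i < s → a n ≤ δ) (k : ℕ) :
    ∑ n ∈ Finset.range k with ∑ i ∈ Finset.range n, a i < s, a n ≤ s + δ := by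
  suffices ∑ n ∈ Finset.range k with ∑ i ∈ Finset.range n, a i < s, a n ≤
      min (∑ i ∈ Finset.range k, a i) (s + δ) from this.trans (min_le_right _ _)
  induction k with
  | zero => simpa using add_nonneg hs hδ
  | succ k ih =>
    rw [le_min_iff] at ih ⊢
    rw [Finset.sum_range_succ, Finset.range_add_one, Finset.filter_insert]
    have := ha k
    split_ifs with hk
    · rw [Finset.sum_insert (by simp)]
      have := h k hk
      constructor <;> linarith
    · exact ⟨by linarith, ih.2⟩

/-- If `aₙ / (a₀ + ⋯ + aₙ) → 0`, then at large scales the terms are small compared to the scale. -/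
theorem exists_scale_of_tendsto_ratio {a : ℕ → ℝ} (ha : ∀ n, 0 < a n)
    (hratio : Tendsto (fun n : ℕ => a n / ∑ i ∈ Finset.range (n + 1), a i) atTop (𝓝 0))
    {L η : ℝ} (hL : 0 < L) (hη : 0 < η) :
    ∃ T : ℝ, 1 ≤ T ∧ ∀ n, ∑ i ∈ Finset.range n, a i ≤ T * L → a n ≤ η * T := by
  set ε := min (1 / 2) (η / (2 * L)) with hε
  have hε0 : 0 < ε := by positivity
  -- From `n₀` on, the part `ε ≤ 1 / 2` absorbs `a n` on the left; the finitely many earlier terms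
  -- are handled by taking `T ≥ A n₀ / η`.
  obtain ⟨n₀, hn₀⟩ := eventually_atTop.1 (hratio.eventually (gt_mem_nhds hε0))
  set A := fun n => ∑ i ∈ Finset.range n, a i with hA
  refine ⟨max 1 (A n₀ / η), le_max_left _ _, fun n hn => ?_⟩
  set T := max 1 (A n₀ / η)
  have hT : A n₀ ≤ η * T := by
    rw [mul_comm, ← div_le_iff₀ hη]; exact le_max_right _ _
  rcases lt_or_ge n n₀ with h | h
  · refine le_trans ?_ hT
    exact Finset.single_le_sum (fun i _ => (ha i).le) (Finset.mem_range.2 h)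
  · have h1 := hn₀ n h
    rw [div_lt_iff₀ (Finset.sum_pos (fun i _ => ha i) (by simp)), Finset.sum_range_succ] at h1
    have hAn : 0 ≤ A n := Finset.sum_nonneg fun i _ => (ha i).le
    have h2 : ε * a n ≤ 1 / 2 * a n := mul_le_mul_of_nonneg_right (min_le_left _ _) (ha n).le
    have h3 : ε * A n ≤ η / (2 * L) * (T * L) :=
      mul_le_mul (min_le_right _ _) hn hAn (by positivity)
    have h4 : η / (2 * L) * (T * L) = η * T / 2 := by field_simp
    have h5 : a n < ε * A n + ε * a n := by rw [← mul_add]; exact h1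
    linarith

/-! ### The sampled decreasing rearrangement -/

namespace WeightedMean

variable {I : Set ℝ} {R : Subring ℝ}

theorem mem_weightVectors_of_positive {a : ℕ → ℝ} (ha : a ∈ positiveWeightSequences R) (n : ℕ) :
    (fun i : Fin (n + 1) => a i) ∈ weightVectors R (n + 1) :=
  ⟨fun i => (ha i).1, fun i => (ha i).2.le, Finset.sum_pos (fun i _ => (ha i).2) (by simp)⟩

/-- Existence of a sequence dominating, at scale `T`, the weighted means of `y`, with almost the
same weighted sum. -/
theorem exists_rearrangement {M : WeightedMean I R} (hsymm : M.IsSymmetric)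
    (hmono : M.IsMonotone) (hI0 : IsGLB I 0) {a b : ℕ → ℝ}
    (ha : a ∈ positiveWeightSequences R) (hb : b ∈ positiveWeightSequences R)
    (hdiv : Tendsto (fun n : ℕ => ∑ i ∈ Finset.range (n + 1), a i) atTop atTop)
    {y : ℕ → ℝ} (hy : ∀ n, y n ∈ I) (N : ℕ) {Y : ℝ} (hY : ∀ n < N, y n ≤ Y) (hY0 : 0 ≤ Y)
    {T η : ℝ} (hT : 1 ≤ T) (hη : 0 < η)
    (hfine : ∀ n, ∑ i ∈ Finset.range n, a i ≤ T * ∑ i ∈ Finset.range N, b i → a n ≤ η * T) :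
    ∃ x : ℕ → ℝ, (∀ n, x n ∈ I) ∧
      (∑' n, ENNReal.ofReal (a n * x n) ≤
        ENNReal.ofReal (T * ∑ m ∈ Finset.range N, b m * y m + η * T * Y + η)) ∧
      ∀ n m, m < N →
        ∑ i ∈ Finset.range (n + 1), a i ≤ T * ∑ i ∈ Finset.range (m + 1), b i →
        M.val (m + 1) (fun i : Fin (m + 1) => y i) (fun i : Fin (m + 1) => b i) ≤
          M.val (n + 1) (fun i : Fin (n + 1) => x i) (fun i : Fin (n + 1) => a i) := by
  have ha0 : ∀ n, 0 < a n := fun n => (ha n).2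
  have hb0 : ∀ n, 0 < b n := fun n => (hb n).2
  have hI : ∀ z ∈ I, 0 ≤ z := fun z hz => hI0.1 hz
  have hT0 : 0 < T := by linarith
  set A : ℕ → ℝ := fun n => ∑ i ∈ Finset.range n, a i with hA
  set β : ℝ → ℝ := fun c => ∑ i ∈ Finset.range N with c ≤ y i, b i with hβ
  have hβ0 : ∀ c, 0 ≤ β c := fun c => Finset.sum_nonneg fun i _ => (hb0 i).le
  have hβanti : ∀ c d, c ≤ d → β d ≤ β c := fun c d hcd =>
    Finset.sum_le_sum_of_subset_of_nonneg
      (Finset.monotone_filter_right _ fun i _ hi => hcd.trans hi) fun i _ _ => (hb0 i).le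
  have hβN : ∀ c, β c ≤ ∑ i ∈ Finset.range N, b i := fun c =>
    Finset.sum_le_sum_of_subset_of_nonneg (Finset.filter_subset _ _) fun i _ _ => (hb0 i).le
  -- `0` need not belong to `I`, so beyond the stretched support the sequence takes values `e n` in
  -- `I` of total weighted sum at most `η`.
  obtain ⟨ε, hε0, hεsum⟩ : ∃ ε : ℕ → ℝ, (∀ n, 0 < ε n) ∧
      ∑' n, ENNReal.ofReal (ε n) ≤ ENNReal.ofReal η := by
    refine ⟨fun n => η * (1 / 2) ^ (n + 1), fun n => by positivity, ?_⟩
    have hs : HasSum (fun n : ℕ => η * (1 / 2 : ℝ) ^ (n + 1)) η := by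
      have h := hasSum_geometric_two.mul_left (η / 2)
      rw [div_mul_cancel₀ η two_ne_zero] at h
      exact h.congr_fun fun n => by ring
    rw [← ENNReal.ofReal_tsum_of_nonneg (fun n => by positivity) hs.summable, hs.tsum_eq]
  have hex : ∀ n, ∃ e ∈ I, a n * e ≤ ε n := fun n => by
    obtain ⟨e, he, -, hlt⟩ := hI0.exists_between (div_pos (hε0 n) (ha0 n))
    exact ⟨e, he, by rw [lt_div_iff₀ (ha0 n)] at hlt; linarith⟩
  choose e heI heε using hex
  -- `g n` is the decreasing rearrangement of `y`, stretched by `T` and evaluated at the left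
  -- endpoint `A n`.
  set J : ℕ → Finset ℕ := fun n => (Finset.range N).filter fun j => A n < T * β (y j) with hJ
  set g : ℕ → ℝ := fun n => if h : (J n).Nonempty then (J n).sup' h y else 0 with hg
  set x : ℕ → ℝ := fun n => if (J n).Nonempty then g n else e n with hx
  have hgJ : ∀ n, (J n).Nonempty → ∃ j ∈ J n, g n = y j := fun n h => by
    obtain ⟨j, hj, hjy⟩ := Finset.exists_mem_eq_sup' h y
    exact ⟨j, hj, by simp only [hg, dif_pos h, hjy]⟩
  have hg0 : ∀ n, ¬ (J n).Nonempty → g n = 0 := fun n h => by simp only [hg, dif_neg h]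
  have hgb : ∀ n, 0 ≤ g n ∧ g n ≤ Y := fun n => by
    by_cases h : (J n).Nonempty
    · obtain ⟨j, hj, hjy⟩ := hgJ n h
      rw [hjy]
      exact ⟨hI _ (hy j), hY j (Finset.mem_range.1 (Finset.mem_filter.1 hj).1)⟩
    · rw [hg0 n h]; exact ⟨le_rfl, hY0⟩
  have hxI : ∀ n, x n ∈ I := fun n => by
    simp only [hx]
    split_ifs with h
    · obtain ⟨j, hj, hjy⟩ := hgJ n h
      rw [hjy]; exact hy j
    · exact heI n
  have hgc : ∀ n c, 0 < c → c ≤ g n → A n < T * β c := fun n c hc hcg => by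
    by_cases h : (J n).Nonempty
    · obtain ⟨j, hj, hjy⟩ := hgJ n h
      exact (Finset.mem_filter.1 hj).2.trans_le
        (mul_le_mul_of_nonneg_left (hβanti _ _ (hjy ▸ hcg)) hT0.le)
    · rw [hg0 n h] at hcg; exact absurd hc hcg.not_gt
  have hxc : ∀ n c, A n < T * β c → c ≤ x n := fun n c h => by
    have hA0 : 0 ≤ A n := Finset.sum_nonneg fun i _ => (ha0 i).le
    have hne : ((Finset.range N).filter fun i => c ≤ y i).Nonempty := by
      by_contra hcon
      rw [Finset.not_nonempty_iff_eq_empty] at hcon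
      simp only [hβ, hcon, Finset.sum_empty, mul_zero] at h
      linarith
    obtain ⟨j, hj, hmin⟩ := Finset.exists_min_image _ y hne
    rw [Finset.mem_filter] at hj
    have hβj : β c ≤ β (y j) := by
      refine Finset.sum_le_sum_of_subset_of_nonneg (fun i hi => ?_) fun i _ _ => (hb0 i).le
      exact Finset.mem_filter.2 ⟨(Finset.mem_filter.1 hi).1, hmin i hi⟩
    have hjJ : j ∈ J n := Finset.mem_filter.2
      ⟨hj.1, h.trans_le (mul_le_mul_of_nonneg_left hβj hT0.le)⟩
    have hJn : (J n).Nonempty := ⟨j, hjJ⟩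
    simp only [hx, hg, if_pos hJn, dif_pos hJn]
    exact hj.2.trans (Finset.le_sup' y hjJ)
  refine ⟨x, hxI, ?_, ?_⟩
  · obtain ⟨k, hk⟩ : ∃ k, ∀ n, k ≤ n → T * ∑ i ∈ Finset.range N, b i ≤ A n := by
      obtain ⟨k, hk⟩ := eventually_atTop.1
        (hdiv.eventually_ge_atTop (T * ∑ i ∈ Finset.range N, b i))
      refine ⟨k + 1, fun n hn => ?_⟩
      obtain ⟨n, rfl⟩ : ∃ l, n = l + 1 := ⟨n - 1, by omega⟩
      exact hk n (by omega)
    have hgk : ∀ n, k ≤ n → g n = 0 := fun n hn => by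
      refine hg0 n ?_
      rintro ⟨j, hj⟩
      have h1 := (Finset.mem_filter.1 hj).2
      have h2 := mul_le_mul_of_nonneg_left (hβN (y j)) hT0.le
      linarith [hk n hn]
    have hreal : ∑ n ∈ Finset.range k, a n * g n ≤
        T * ∑ m ∈ Finset.range N, b m * y m + η * T * Y := by
      have := sum_mul_le_of_tail_sum_le (Finset.range k) (Finset.range N) (u := a) (x := g)
        (v := fun m => T * b m) (y := y) (K := η * T) hY0 (fun i _ => hgb i)
        (fun j hj => ⟨hI _ (hy j), hY j (Finset.mem_range.1 hj)⟩) fun c hc => by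
          rw [← Finset.mul_sum]
          refine le_trans (Finset.sum_le_sum_of_subset_of_nonneg
            (Finset.monotone_filter_right _ fun n _ hn => hgc n c hc hn)
            fun i _ _ => (ha0 i).le) ?_
          refine sum_filter_partial_sum_lt_le a (T * β c) (η * T) (fun n => (ha0 n).le)
            (mul_nonneg hT0.le (hβ0 c)) (by positivity) (fun n hn => hfine n ?_) k
          exact hn.le.trans (mul_le_mul_of_nonneg_left (hβN c) hT0.le)
      simpa only [Finset.mul_sum, mul_assoc] using this
    calc ∑' n, ENNReal.ofReal (a n * x n)
        ≤ ∑' n, (ENNReal.ofReal (a n * g n) + ENNReal.ofReal (ε n)) := by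
          refine ENNReal.tsum_le_tsum fun n => ?_
          by_cases h : (J n).Nonempty
          · simp only [hx, if_pos h]; exact le_self_add
          · simp only [hx, if_neg h]
            exact (ENNReal.ofReal_le_ofReal (heε n)).trans le_add_self
      _ = ∑ n ∈ Finset.range k, ENNReal.ofReal (a n * g n) + ∑' n, ENNReal.ofReal (ε n) := by
          rw [ENNReal.tsum_add]
          congr 1
          refine tsum_eq_sum fun n hn => ?_
          rw [hgk n (by simpa using hn)]; simp
      _ ≤ ENNReal.ofReal (T * ∑ m ∈ Finset.range N, b m * y m + η * T * Y) +
            ENNReal.ofReal η := by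
          rw [← ENNReal.ofReal_sum_of_nonneg fun n _ => mul_nonneg (ha0 n).le (hgb n).1]
          exact add_le_add (ENNReal.ofReal_le_ofReal hreal) hεsum
      _ = _ := by
          rw [← ENNReal.ofReal_add _ hη.le]
          have : 0 ≤ ∑ m ∈ Finset.range N, b m * y m :=
            Finset.sum_nonneg fun m _ => mul_nonneg (hb0 m).le (hI _ (hy m))
          positivity
  · intro n m hm hnm
    refine val_le_val_of_stochastic_dominance hsymm hmono (fun i => hy _) (fun i => hxI _)
      (mem_weightVectors_of_positive hb m) (mem_weightVectors_of_positive ha n) fun c => ?_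
    have hconv : ∀ (z f : ℕ → ℝ) (l : ℕ),
        ∑ i ∈ Finset.univ.filter (fun i : Fin l => c ≤ z i), f i =
          ∑ i ∈ Finset.range l with c ≤ z i, f i := fun z f l => by
      rw [Finset.sum_filter, Finset.sum_filter,
        Fin.sum_univ_eq_sum_range (fun i => if c ≤ z i then f i else 0)]
    rw [hconv y b, hconv x a, Fin.sum_univ_eq_sum_range, Fin.sum_univ_eq_sum_range]
    set P := ∑ i ∈ Finset.range (m + 1) with c ≤ y i, b i
    have hP0 : 0 ≤ P := Finset.sum_nonneg fun i _ => (hb0 i).le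
    have hPβ : P ≤ β c := Finset.sum_le_sum_of_subset_of_nonneg
      (Finset.filter_subset_filter _ (Finset.range_subset_range.2 hm)) fun i _ _ => (hb0 i).le
    have hPB : P ≤ ∑ i ∈ Finset.range (m + 1), b i :=
      Finset.sum_le_sum_of_subset_of_nonneg (Finset.filter_subset _ _) fun i _ _ => (hb0 i).le
    have hQ : min (A (n + 1)) (T * β c) ≤ ∑ i ∈ Finset.range (n + 1) with c ≤ x i, a i :=
      (min_le_sum_filter_partial_sum_lt a (T * β c)
        (mul_nonneg hT0.le (hβ0 c)) (n + 1)).trans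
        (Finset.sum_le_sum_of_subset_of_nonneg
          (Finset.monotone_filter_right _ fun i _ hi => hxc i c hi) fun i _ _ => (ha0 i).le)
    set B := ∑ i ∈ Finset.range (m + 1), b i
    have hB0 : 0 ≤ B := Finset.sum_nonneg fun i _ => (hb0 i).le
    have hA0 : 0 ≤ A (n + 1) := Finset.sum_nonneg fun i _ => (ha0 i).le
    refine le_trans ?_ (mul_le_mul_of_nonneg_left hQ hB0)
    -- The two cases use `P ≤ B`, and `P ≤ β c` with `A (n + 1) ≤ T * B`, respectively.
    rw [mul_min_of_nonneg _ _ hB0]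
    refine le_min ?_ ?_
    · rw [mul_comm]; exact mul_le_mul_of_nonneg_right hPB hA0
    · calc A (n + 1) * P ≤ (T * B) * β c := mul_le_mul hnm hPβ hP0 (by positivity)
        _ = B * (T * β c) := by ring

/-! ### Comparison of Hardy constants -/

/-- The Hardy constant of a divergent weight sequence with `aₙ / (a₀ + ⋯ + aₙ) → 0` is the largest
among all weight sequences. -/
theorem hardyConstant_le {M : WeightedMean I R} (hsymm : M.IsSymmetric) (hmono : M.IsMonotone)
    (hI0 : IsGLB I 0) {a b : ℕ → ℝ}
    (ha : a ∈ positiveWeightSequences R) (hb : b ∈ positiveWeightSequences R)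
    (hdiv : Tendsto (fun n : ℕ => ∑ i ∈ Finset.range (n + 1), a i) atTop atTop)
    (hratio : Tendsto (fun n : ℕ => a n / ∑ i ∈ Finset.range (n + 1), a i) atTop (𝓝 0)) :
    M.hardyConstant b ≤ M.hardyConstant a := by
  have ha0 : ∀ n, 0 < a n := fun n => (ha n).2
  have hb0 : ∀ n, 0 < b n := fun n => (hb n).2
  have hI : ∀ z ∈ I, 0 ≤ z := fun z hz => hI0.1 hz
  refine le_sInf fun C hC => ?_
  rcases eq_or_ne C ⊤ with rfl | hCtop
  · exact le_top
  lift C to NNReal using hCtop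
  refine sInf_le fun y hy => ?_
  set V : ℕ → ℝ := fun m => M.val (m + 1) (fun i : Fin (m + 1) => y i)
    (fun i : Fin (m + 1) => b i) with hV
  have hV0 : ∀ m, 0 ≤ V m := fun m =>
    hI _ (M.val_mem _ _ _ (fun i => hy _) (mem_weightVectors_of_positive hb m))
  refine ENNReal.tsum_le_of_sum_range_le fun N => ?_
  suffices hmain : ∑ m ∈ Finset.range N, b m * V m ≤ C * ∑ m ∈ Finset.range N, b m * y m by
    have hby : ∀ m, 0 ≤ b m * y m := fun m => mul_nonneg (hb0 m).le (hI _ (hy m))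
    calc ∑ m ∈ Finset.range N, ENNReal.ofReal (b m * V m)
        = ENNReal.ofReal (∑ m ∈ Finset.range N, b m * V m) :=
          (ENNReal.ofReal_sum_of_nonneg fun m _ => mul_nonneg (hb0 m).le (hV0 m)).symm
      _ ≤ ENNReal.ofReal (C * ∑ m ∈ Finset.range N, b m * y m) := ENNReal.ofReal_le_ofReal hmain
      _ = C * ∑ m ∈ Finset.range N, ENNReal.ofReal (b m * y m) := by
          rw [ENNReal.ofReal_mul C.coe_nonneg, ENNReal.ofReal_sum_of_nonneg fun m _ => hby m]
          simp
      _ ≤ _ := mul_le_mul_right (ENNReal.sum_le_tsum _) _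
  set B : ℕ → ℝ := fun n => ∑ i ∈ Finset.range n, b i with hB
  set A : ℕ → ℝ := fun n => ∑ i ∈ Finset.range n, a i with hA
  have hBmono : Monotone B := fun m n hmn =>
    Finset.sum_le_sum_of_subset_of_nonneg (Finset.range_subset_range.2 hmn)
      fun i _ _ => (hb0 i).le
  have hAmono : Monotone A := fun m n hmn =>
    Finset.sum_le_sum_of_subset_of_nonneg (Finset.range_subset_range.2 hmn)
      fun i _ _ => (ha0 i).le
  have hBnn : ∀ n, 0 ≤ B n := fun n => Finset.sum_nonneg fun i _ => (hb0 i).le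
  set Y := ∑ m ∈ Finset.range N, y m with hYdef
  have hY0 : 0 ≤ Y := Finset.sum_nonneg fun m _ => hI _ (hy m)
  have hY : ∀ n < N, y n ≤ Y := fun n hn =>
    Finset.single_le_sum (fun m _ => hI _ (hy m)) (Finset.mem_range.2 hn)
  set S := ∑ m ∈ Finset.range N, b m * y m with hS
  have hS0 : 0 ≤ S := Finset.sum_nonneg fun m _ => mul_nonneg (hb0 m).le (hI _ (hy m))
  set K : ℝ := ∑ m ∈ Finset.range N, V m + C * (Y + 1) with hK
  have hK0 : 0 ≤ K := add_nonneg (Finset.sum_nonneg fun m _ => hV0 m)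
    (mul_nonneg C.2 (by linarith))
  suffices hη : ∀ η : ℝ, 0 < η → ∑ m ∈ Finset.range N, b m * V m ≤ C * S + η * K by
    refine le_of_forall_pos_le_add fun δ hδ => ?_
    have h1 := hη (δ / (K + 1)) (by positivity)
    have h2 : δ / (K + 1) * K ≤ δ := by
      rw [div_mul_eq_mul_div, div_le_iff₀ (by positivity)]
      nlinarith
    linarith
  intro η hη
  -- The `+ 1` keeps the scale positive when `N = 0`.
  obtain ⟨T, hT, hfine⟩ := exists_scale_of_tendsto_ratio ha0 hratio
    (L := B N + 1) (by linarith [hBnn N]) hη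
  have hT0 : 0 < T := by linarith
  have hfine' : ∀ n, A n ≤ T * B N → a n ≤ η * T := fun n hn =>
    hfine n (hn.trans (mul_le_mul_of_nonneg_left (by linarith) hT0.le))
  obtain ⟨x, hxI, hxsum, hxdom⟩ := exists_rearrangement hsymm hmono hI0 ha hb hdiv hy N hY hY0 hT
    hη hfine'
  set X : ℕ → ℝ := fun n => M.val (n + 1) (fun i : Fin (n + 1) => x i)
    (fun i : Fin (n + 1) => a i) with hX
  have hX0 : ∀ n, 0 ≤ X n := fun n =>
    hI _ (M.val_mem _ _ _ (fun i => hxI _) (mem_weightVectors_of_positive ha n))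
  have hupper : ∀ k, ∑ n ∈ Finset.range k, a n * X n ≤ C * (T * S + η * T * Y + η) := by
    intro k
    have hnn : 0 ≤ C * (T * S + η * T * Y + η) := by positivity
    rw [← ENNReal.ofReal_le_ofReal_iff hnn,
      ENNReal.ofReal_sum_of_nonneg fun n _ => mul_nonneg (ha0 n).le (hX0 n),
      ENNReal.ofReal_mul C.coe_nonneg]
    refine (ENNReal.sum_le_tsum _).trans ((hC x hxI).trans ?_)
    rw [ENNReal.ofReal_coe_nnreal]
    exact mul_le_mul_right hxsum _
  have hcross : ∀ t : ℝ, 0 ≤ t → ∃ k, A k ≤ t ∧ t < A (k + 1) := by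
    intro t ht
    have hex : ∃ n, t < A (n + 1) := (hdiv.eventually_gt_atTop t).exists
    classical
    refine ⟨Nat.find hex, ?_, Nat.find_spec hex⟩
    rcases h : Nat.find hex with _ | k
    · simpa [hA] using ht
    · exact not_lt.1 (Nat.find_min hex (m := k) (by omega))
  -- The grid steps from `k` to `k'` fill the block from `T * B m` to `T * B (m + 1)` up to one step
  -- of length at most `η * T`, and on them `X n ≥ V m`.
  have hlower : ∀ m ≤ N, ∃ k, A k ≤ T * B m ∧ T * B m < A (k + 1) ∧
      ∑ l ∈ Finset.range m, (T * b l - η * T) * V l ≤ ∑ n ∈ Finset.range k, a n * X n := by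
    intro m
    induction m with
    | zero =>
      intro _
      exact ⟨0, by simp [hA, hB], by simpa [hA, hB] using ha0 0, by simp⟩
    | succ m ih =>
      intro hm
      obtain ⟨k, hk1, hk2, hk3⟩ := ih (by omega)
      obtain ⟨k', hk1', hk2'⟩ := hcross (T * B (m + 1)) (mul_nonneg hT0.le (hBnn _))
      refine ⟨k', hk1', hk2', ?_⟩
      have hTB : T * B m ≤ T * B (m + 1) :=
        mul_le_mul_of_nonneg_left (hBmono (Nat.le_succ m)) hT0.le
      have hkk : k ≤ k' := by
        by_contra! hlt
        have : A (k' + 1) ≤ A k := hAmono hlt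
        linarith
      rw [Finset.sum_range_succ, ← Finset.sum_range_add_sum_Ico _ hkk]
      refine add_le_add hk3 ?_
      have h1 : ∑ n ∈ Finset.Ico k k', a n * V m ≤ ∑ n ∈ Finset.Ico k k', a n * X n := by
        refine Finset.sum_le_sum fun n hn => mul_le_mul_of_nonneg_left ?_ (ha0 n).le
        refine hxdom n m (by omega) (le_trans ?_ hk1')
        exact hAmono (Finset.mem_Ico.1 hn).2
      refine le_trans ?_ h1
      rw [← Finset.sum_mul]
      refine mul_le_mul_of_nonneg_right ?_ (hV0 m)
      have h2 : A k + ∑ n ∈ Finset.Ico k k', a n = A k' :=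
        Finset.sum_range_add_sum_Ico _ hkk
      have h3 : A (k' + 1) = A k' + a k' := Finset.sum_range_succ _ _
      have h4 : a k' ≤ η * T := hfine' k'
        (hk1'.trans (mul_le_mul_of_nonneg_left (hBmono hm) hT0.le))
      have h5 : T * B (m + 1) = T * B m + T * b m := by
        rw [← mul_add]; exact congrArg _ (Finset.sum_range_succ _ _)
      linarith
  obtain ⟨k, -, -, hk⟩ := hlower N le_rfl
  have h1 := hk.trans (hupper k)
  have h2 : ∑ l ∈ Finset.range N, (T * b l - η * T) * V l =
      T * (∑ l ∈ Finset.range N, b l * V l - η * ∑ l ∈ Finset.range N, V l) := by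
    rw [Finset.mul_sum, ← Finset.sum_sub_distrib, Finset.mul_sum]
    exact Finset.sum_congr rfl fun l _ => by ring
  have h3 : C * (T * S + η * T * Y + η) ≤ T * (C * S + η * (C * (Y + 1))) := by
    have : (C : ℝ) * η ≤ C * η * T := le_mul_of_one_le_right (by positivity) hT
    nlinarith
  rw [h2] at h1
  have h4 := le_of_mul_le_mul_left (h1.trans h3) hT0
  rw [hK, mul_add]
  linarith

end WeightedMean

theorem theorem3p2 (I : Set ℝ) (hI : I.OrdConnected) (hI0 : IsGLB I 0)
    (R : Subring ℝ) (M : WeightedMean I R) (hsymm : M.IsSymmetric) (hmono : M.IsMonotone)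
    (w : ℕ → ℝ) (hw : w ∈ positiveWeightSequences R)
    (hdiv : Tendsto (fun n : ℕ => ∑ i ∈ Finset.range (n + 1), w i) atTop atTop)
    (hratio : Tendsto (fun n : ℕ => w n / ∑ i ∈ Finset.range (n + 1), w i) atTop (𝓝 0)) :
    M.hardyConstant w = M.hardyConstant (fun _ => 1) := by
  have h1 : (fun _ => 1 : ℕ → ℝ) ∈ positiveWeightSequences R := fun _ => ⟨R.one_mem, one_pos⟩
  refine le_antisymm (WeightedMean.hardyConstant_le hsymm hmono hI0 h1 hw ?_ ?_)
    (WeightedMean.hardyConstant_le hsymm hmono hI0 hw h1 hdiv hratio)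
  · simpa using tendsto_atTop_add_const_right atTop (1 : ℝ) tendsto_natCast_atTop_atTop
  · simpa using tendsto_one_div_add_atTop_nhds_zero_nat (𝕜 := ℝ)
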